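/- Let $L_1,L_2,\dots$ be natural numbers, let $\mathcal A=\prod_{j=1}^\infty\{1,\dots,L_j\}$ with its Borel (product) $\sigma$-algebra $\mathcal B(\mathcal A)$ and coordinate maps $X_j$, and let $\mathcal X=\bigcap_n\sigma(X_n,X_{n+1},\dots)$ be the tail $\sigma$-algebra. Let $P$ be the set of all real families $\beta=(\beta_{jl})_{j\ge 1,\,1\le l\le L_j}$ with $0\le\beta_{jl}\le1$ and $\sum_{l}\beta_{jl}=1$ for every $j$; for $\beta\in P$ let $\mathsf P_\beta$ be the probability measure on $\mathcal A$ under which the $X_j$ are independent with $\mathsf P_\beta(X_j=l)=\beta_{jl}$. Fix linearly independent $\lambda^1,\dots,\lambda^K\in P$, put $$Q=\Big\{g\in\mathbb R^K \;\Big|\; \sum_k g_k=1,\ \beta(g):=\sum_k g_k\lambda^k\in P\Big\},$$ and write $\mathsf P_g=\mathsf P_{\beta(g)}$ for $g\in Q$. For a Borel probability measure $\mu$ on $Q$ let $\mathsf P_\mu(A)=\int_Q\mathsf P_g(A)\,\mu(dg)$, $A\in\mathcal B(\mathcal A)$, be the mixture of the $\mathsf P_g$. For $A\in\mathcal X$ put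 $hA=\{g\in Q\mid \mathsf P_g(A)=1\}$. The symbol $\perp$ denotes orthogonality (mutual singularity) of measures. (1) Suppose that $\mathsf P_{g'}\perp\mathsf P_{g''}$ for all $g',g''\in Q$ with $g'\ne g''$. Then for all Borel probability measures $\mu_1,\mu_2$ on $Q$ with $\mu_1\perp\mu_2$, the mixtures are orthogonal, $\mathsf P_{\mu_1}\perp\mathsf P_{\mu_2}$, and already their restrictions to the tail $\sigma$-algebra are orthogonal, $\mathsf P_{\mu_1}|_{\mathcal X}\perp\mathsf P_{\mu_2}|_{\mathcal X}$. (2) For every such family $\{\mathsf P_g\}_{g\in Q}$ (pairwise orthogonal or not) the following are equivalent: (a) for all Borel probability measures $\mu_1\perp\mu_2$ on $Q$ one has $\mathsf P_{\mu_1}\perp\mathsf P_{\mu_2}$; (b) for all Borel probability measures $\mu_1\perp\mu_2$ on $Q$ one has $\mathsf P_{\mu_1}|_{\mathcal X}\perp\mathsf P_{\mu_2}|_{\mathcal X}$; (c) for every Borel probability measure $\mu$ on $Q$ and every Borel set $B\subseteq Q$ there is $A\in\mathcal X$ with $\mu(B\bigtriangleup hA)=0$. -/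

import Mathlib

open MeasureTheory ProbabilityTheory

namespace IndepMix

/-- The space of outcomes `𝒜 = ∏ⱼ {1, …, Lⱼ}`, with its product (= Borel) σ-algebra. -/
abbrev Outcome (L : ℕ → ℕ) : Type := ∀ j, Fin (L j)

/-- The linear space of all families of reals `(β_{jl})`, `l = 1, …, Lⱼ`. -/
abbrev Coeff (L : ℕ → ℕ) : Type := ∀ j, Fin (L j) → ℝ

/-- The convex body of those `β` for which every `(β_{jl})_l` is a probability vector. -/
def body (L : ℕ → ℕ) : Set (Coeff L) :=
  {β | (∀ j l, 0 ≤ β j l ∧ β j l ≤ 1) ∧ ∀ j, ∑ l, β j l = 1}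

/-- The distribution of the `j`-th coordinate: the value `l` has probability `β_{jl}`. -/
noncomputable def coordDist {L : ℕ → ℕ} (β : Coeff L) (j : ℕ) : Measure (Fin (L j)) :=
  ∑ l, ENNReal.ofReal (β j l) • Measure.dirac l

instance isProbabilityMeasure_coordDist {L : ℕ → ℕ} (β : body L) (j : ℕ) :
    IsProbabilityMeasure (coordDist β.1 j) := by
  constructor
  simp only [coordDist, Measure.coe_finsetSum, Finset.sum_apply, Measure.smul_apply,
    measure_univ, smul_eq_mul, mul_one]
  rw [← ENNReal.ofReal_sum_of_nonneg (fun l _ => (β.2.1 j l).1), β.2.2 j, ENNReal.ofReal_one]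

/-- The independent distribution `P_β` on `𝒜`. -/
noncomputable def indepDist {L : ℕ → ℕ} (β : body L) : Measure (Outcome L) :=
  Measure.infinitePi (coordDist β.1)

instance isProbabilityMeasure_indepDist {L : ℕ → ℕ} (β : body L) :
    IsProbabilityMeasure (indepDist β) := by
  unfold indepDist; infer_instance

/-- `Q`: the points `g` of the hyperplane `∑ₖ gₖ = 1` of `ℝᴷ` with `∑ₖ gₖ λᵏ` in the body. -/
def paramSet {L : ℕ → ℕ} {K : ℕ} (lam : Fin K → Coeff L) : Set (Fin K → ℝ) :=
  {g | ∑ k, g k = 1 ∧ ∑ k, g k • lam k ∈ body L}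

/-- The parametrization `β(g) = ∑ₖ gₖ λᵏ`. -/
def betaMap {L : ℕ → ℕ} {K : ℕ} (lam : Fin K → Coeff L) (g : paramSet lam) : body L :=
  ⟨∑ k, g.1 k • lam k, g.2.2⟩

theorem measurable_indepDist_betaMap {L : ℕ → ℕ} {K : ℕ} (lam : Fin K → Coeff L) :
    Measurable fun g : paramSet lam => indepDist (betaMap lam g) := by
  refine Measurable.measure_of_isPiSystem_of_isProbabilityMeasure
    generateFrom_squareCylinders.symm
    (isPiSystem_squareCylinders (fun _ => MeasurableSpace.isPiSystem_measurableSet) (by simp)) ?_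
  rintro S ⟨s, t, -, rfl⟩
  have hS : ∀ g : paramSet lam, indepDist (betaMap lam g) ((s : Set ℕ).pi t)
      = ∏ j ∈ s, ∑ l, ENNReal.ofReal (∑ k, g.1 k * lam k j l) * Measure.dirac l (t j) := by
    intro g
    rw [indepDist, Measure.infinitePi_pi _ (fun j _ => .of_discrete)]
    refine Finset.prod_congr rfl fun j _ => ?_
    simp [coordDist, betaMap, Finset.sum_apply]
  simp only [hS]
  refine Finset.measurable_fun_prod _ fun j _ => Finset.measurable_fun_sum _ fun l _ => ?_
  refine Measurable.mul_const (Measurable.ennreal_ofReal ?_) _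
  exact Finset.measurable_fun_sum _ fun k _ =>
    ((measurable_pi_apply k).comp measurable_subtype_coe).mul_const _

/-- `g ↦ P_g = P_{β(g)}`, as a Markov kernel from `Q` to `𝒜`. -/
noncomputable def indepKernel {L : ℕ → ℕ} {K : ℕ} (lam : Fin K → Coeff L) :
    Kernel (paramSet lam) (Outcome L) where
  toFun g := indepDist (betaMap lam g)
  measurable' := measurable_indepDist_betaMap lam

/-- The mixture `P_μ(A) = ∫ P_g(A) μ(dg)`. -/
noncomputable def mix {L : ℕ → ℕ} {K : ℕ} (lam : Fin K → Coeff L)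
    (μ : Measure (paramSet lam)) : Measure (Outcome L) :=
  μ.bind (indepKernel lam)

theorem mix_apply {L : ℕ → ℕ} {K : ℕ} (lam : Fin K → Coeff L) (μ : Measure (paramSet lam))
    {A : Set (Outcome L)} (hA : MeasurableSet A) :
    mix lam μ A = ∫⁻ g, indepDist (betaMap lam g) A ∂μ :=
  Measure.bind_apply hA (indepKernel lam).measurable.aemeasurable

/-- The tail σ-algebra `⋂ₙ σ(Xₙ, Xₙ₊₁, …)` on `𝒜`, where `Xⱼ` is the `j`-th coordinate. -/
@[reducible] def tail (L : ℕ → ℕ) : MeasurableSpace (Outcome L) :=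
  ⨅ n : ℕ, cylinderEvents {j | n ≤ j}

theorem tail_le (L : ℕ → ℕ) : tail L ≤ MeasurableSpace.pi :=
  (iInf_le _ 0).trans cylinderEvents_le_pi

/-- `hA = {g ∈ Q | P_g(A) = 1}`. -/
def hMap {L : ℕ → ℕ} {K : ℕ} (lam : Fin K → Coeff L) (A : Set (Outcome L)) :
    Set (paramSet lam) :=
  {g | indepDist (betaMap lam g) A = 1}

/-- The measures `P_g`, `g ∈ Q`, are pairwise orthogonal. -/
def PairwiseOrthogonal {L : ℕ → ℕ} {K : ℕ} (lam : Fin K → Coeff L) : Prop :=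
  ∀ g g' : paramSet lam, g ≠ g' →
    (indepDist (betaMap lam g)).MutuallySingular (indepDist (betaMap lam g'))

/-- Two measures on `𝒜`, restricted to the tail σ-algebra, are orthogonal. -/
def TailOrthogonal {L : ℕ → ℕ} (P P' : Measure (Outcome L)) : Prop :=
  (P.trim (tail_le L)).MutuallySingular (P'.trim (tail_le L))

end IndepMix

namespace IndepMix

/-! Pairwise orthogonality already yields one tail-measurable `f` with `f = g` almost surely under
`P_g`, for every `g`; preimages under `f` are then tail events deciding every Borel set of
parameters (`exists_tail_event`), hence separating mixtures of singular `μ₁`, `μ₂`. To get `f`: if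
the χ²-type information in a nonzero direction `v` with `∑ vₖ = 0` were finite, the barycentre and a
small shift of it along `v` would give product measures one of which is absolutely continuous with
respect to the other (`indepDist_absolutelyContinuous`). So it is infinite, and by Hahn–Banach
duality the functionals estimable from late coordinates with small variance are dense
(`dense_estimable`). Estimators of functionals approaching a coordinate, with summable variances,
converge almost surely to that coordinate. Conversely, (a) gives orthogonality through Dirac
measures, and (c) through two-point mixtures and the zero–one law. -/

/-! ### Absolute continuity of product measures. -/

theorem coordDist_singleton {L : ℕ → ℕ} (β : Coeff L) (j : ℕ) (l : Fin (L j)) :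
    coordDist β j {l} = ENNReal.ofReal (β j l) := by
  simp [coordDist, Measure.coe_finsetSum, Finset.sum_apply, Set.indicator_apply]

theorem coordDist_real_singleton {L : ℕ → ℕ} (β : body L) (j : ℕ) (l : Fin (L j)) :
    (coordDist β.1 j).real {l} = β.1 j l := by
  rw [measureReal_def, coordDist_singleton, ENNReal.toReal_ofReal (β.2.1 j l).1]

theorem indepDist_real_cylinder {L : ℕ → ℕ} (β : body L) (I : Finset ℕ)
    (S : Finset (∀ i : I, Fin (L i))) :
    (indepDist β).real (cylinder I (S : Set (∀ i : I, Fin (L i))))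
      = ∑ x ∈ S, ∏ i : I, β.1 i (x i) := by
  rw [measureReal_def, indepDist, Measure.infinitePi_cylinder _ S.measurableSet,
    ← measureReal_def, ← sum_measureReal_singleton]
  refine Finset.sum_congr rfl fun x _ => ?_
  rw [measureReal_def, Measure.pi_singleton, ENNReal.toReal_prod]
  exact Finset.prod_congr rfl fun i _ => coordDist_real_singleton β i (x i)

/-- Cauchy–Schwarz for the likelihood ratio on cylinder sets. -/
theorem sq_indepDist_real_cylinder_le {L : ℕ → ℕ} (p q : body L)
    (hpq : ∀ j l, p.1 j l = 0 → q.1 j l = 0) (I : Finset ℕ)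
    (S : Finset (∀ i : I, Fin (L i))) :
    (indepDist q).real (cylinder I (S : Set (∀ i : I, Fin (L i)))) ^ 2
      ≤ (∏ j ∈ I, ∑ l, q.1 j l ^ 2 / p.1 j l)
        * (indepDist p).real (cylinder I (S : Set (∀ i : I, Fin (L i)))) := by
  rw [indepDist_real_cylinder, indepDist_real_cylinder]
  have hp : ∀ j l, 0 ≤ p.1 j l := fun j l => (p.2.1 j l).1
  refine (Finset.sum_sq_le_sum_mul_sum_of_sq_le_mul S
    (f := fun x => ∏ i : I, (q.1 i (x i) ^ 2 / p.1 i (x i)))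
    (g := fun x => ∏ i : I, p.1 i (x i)) ?_ ?_ ?_).trans ?_
  · exact fun x _ => Finset.prod_nonneg fun i _ => div_nonneg (sq_nonneg _) (hp _ _)
  · exact fun x _ => Finset.prod_nonneg fun i _ => hp _ _
  · intro x _
    refine le_of_eq ?_
    rw [← Finset.prod_mul_distrib, ← Finset.prod_pow]
    refine Finset.prod_congr rfl fun i _ => ?_
    by_cases h : p.1 i (x i) = 0
    · simp [h, hpq _ _ h]
    · rw [div_mul_cancel₀ _ h]
  · refine mul_le_mul_of_nonneg_right ?_
      (Finset.sum_nonneg fun x _ => Finset.prod_nonneg fun i _ => hp _ _)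
    rw [← Finset.prod_coe_sort I, Finset.prod_univ_sum]
    simp only [Fintype.piFinset_univ]
    exact Finset.sum_le_univ_sum_of_nonneg
      fun x => Finset.prod_nonneg fun i _ => div_nonneg (sq_nonneg _) (hp _ _)

/-- Puts each Cauchy–Schwarz factor in the form `1 + χ²`, so that their products are bounded by the
exponential of the χ² sum. -/
theorem sum_sq_div_eq {L : ℕ → ℕ} (p q : body L)
    (hpq : ∀ j l, p.1 j l = 0 → q.1 j l = 0) (j : ℕ) :
    ∑ l, q.1 j l ^ 2 / p.1 j l = 1 + ∑ l, (q.1 j l - p.1 j l) ^ 2 / p.1 j l := by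
  have h : ∀ l, q.1 j l ^ 2 / p.1 j l
      = (q.1 j l - p.1 j l) ^ 2 / p.1 j l + 2 * q.1 j l - p.1 j l := by
    intro l
    by_cases h : p.1 j l = 0
    · simp [h, hpq _ _ h]
    · field_simp
      ring
  simp only [h, Finset.sum_sub_distrib, Finset.sum_add_distrib, ← Finset.mul_sum, p.2.2 j, q.2.2 j]
  ring

/-- A summable `χ²`-distance between the factors makes the product measures absolutely
continuous. -/
theorem indepDist_absolutelyContinuous {L : ℕ → ℕ} (p q : body L)
    (hpq : ∀ j l, p.1 j l = 0 → q.1 j l = 0)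
    (hsum : Summable fun j => ∑ l, (q.1 j l - p.1 j l) ^ 2 / p.1 j l) :
    indepDist q ≪ indepDist p := by
  have hnn : ∀ j, 0 ≤ ∑ l, (q.1 j l - p.1 j l) ^ 2 / p.1 j l := fun j =>
    Finset.sum_nonneg fun l _ => div_nonneg (sq_nonneg _) (p.2.1 j l).1
  set C := Real.exp (∑' j, ∑ l, (q.1 j l - p.1 j l) ^ 2 / p.1 j l)
  have hC : 0 < C := Real.exp_pos _
  have hcyl : ∀ A ∈ measurableCylinders (fun j => Fin (L j)),
      (indepDist q).real A ^ 2 ≤ C * (indepDist p).real A := by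
    classical
    intro A hA
    obtain ⟨I, S, -, rfl⟩ := (mem_measurableCylinders _).1 hA
    have := sq_indepDist_real_cylinder_le p q hpq I S.toFinset
    rw [Set.coe_toFinset] at this
    refine this.trans (mul_le_mul_of_nonneg_right ?_ measureReal_nonneg)
    simp only [sum_sq_div_eq p q hpq]
    calc ∏ j ∈ I, (1 + ∑ l, (q.1 j l - p.1 j l) ^ 2 / p.1 j l)
        ≤ ∏ j ∈ I, Real.exp (∑ l, (q.1 j l - p.1 j l) ^ 2 / p.1 j l) :=
          Finset.prod_le_prod (fun j _ => add_nonneg zero_le_one (hnn j))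
            fun j _ => by rw [add_comm]; exact Real.add_one_le_exp _
      _ ≤ C := by
          rw [← Real.exp_sum]
          exact Real.exp_le_exp.2 (hsum.sum_le_tsum I fun j _ => hnn j)
  refine Measure.AbsolutelyContinuous.mk fun A hA hA0 => ?_
  rw [← measureReal_eq_zero_iff]
  refine le_antisymm (le_of_forall_pos_le_add fun ε hε => ?_) measureReal_nonneg
  -- The first bound controls the approximation error; the second makes `C * δ ≤ (ε / 2) ^ 2`.
  set δ : ℝ := min (ε / 2) (ε ^ 2 / (4 * C))
  have hδ : 0 < δ := lt_min (by positivity) (by positivity)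
  -- Approximating in the sum of the two measures gives one cylinder that is good for both.
  obtain ⟨B, hB, hBA⟩ := exists_measure_symmDiff_lt_of_generateFrom_isSetRing
    (μ := indepDist p + indepDist q) (isSetRing_measurableCylinders (α := fun j => Fin (L j)))
    ⟨{Set.univ}, Set.countable_singleton _, 
      Set.singleton_subset_iff.2 (univ_mem_measurableCylinders _), by simp⟩
    generateFrom_measurableCylinders.symm hA (ENNReal.ofReal_pos.2 hδ)
  have hBm : MeasurableSet B := MeasurableSet.of_mem_measurableCylinders hB
  rw [Measure.add_apply] at hBA
  have hp : (indepDist p).real (symmDiff B A) ≤ δ :=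
    ENNReal.toReal_le_of_le_ofReal hδ.le (le_self_add.trans hBA.le)
  have hq : (indepDist q).real (symmDiff B A) ≤ δ :=
    ENNReal.toReal_le_of_le_ofReal hδ.le (le_add_self.trans hBA.le)
  have hpB : (indepDist p).real B ≤ δ := by
    refine (measureReal_le_measureReal_union_left (t := A) ).trans ?_
    rw [show B ∪ A = symmDiff B A ∪ A by ext; simp [Set.mem_symmDiff]; tauto]
    refine (measureReal_union_le _ _).trans ?_
    rw [(measureReal_eq_zero_iff (s := A)).2 hA0, add_zero]
    exact hp
  have hqB : (indepDist q).real B ≤ ε / 2 := by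
    refine abs_le_of_sq_le_sq' ?_ (by positivity) |>.2
    calc (indepDist q).real B ^ 2 ≤ C * (indepDist p).real B := hcyl B hB
      _ ≤ C * (ε ^ 2 / (4 * C)) :=
          mul_le_mul_of_nonneg_left (hpB.trans (min_le_right _ _)) hC.le
      _ = (ε / 2) ^ 2 := by field_simp; ring
  calc (indepDist q).real A ≤ (indepDist q).real (symmDiff B A ∪ B) :=
        measureReal_mono (by intro x hx; simp [Set.mem_symmDiff]; tauto)
    _ ≤ δ + ε / 2 := (measureReal_union_le _ _).trans (add_le_add hq hqB)
    _ ≤ 0 + ε := by have := min_le_left (ε / 2) (ε ^ 2 / (4 * C)); linarith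

/-! ### Information in the directions of the parameter set. -/

theorem betaMap_apply {L : ℕ → ℕ} {K : ℕ} (lam : Fin K → Coeff L) (g : paramSet lam)
    (j : ℕ) (l : Fin (L j)) : (betaMap lam g).1 j l = ∑ k, g.1 k * lam k j l := by
  simp [betaMap, Finset.sum_apply]

theorem mem_paramSet {L : ℕ → ℕ} {K : ℕ} {lam : Fin K → Coeff L} (hlam : ∀ k, lam k ∈ body L)
    {g : Fin K → ℝ} (hg : ∑ k, g k = 1) (hnn : ∀ j l, 0 ≤ ∑ k, g k * lam k j l) :
    g ∈ paramSet lam := by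
  have hone : ∀ j, ∑ l, ∑ k, g k * lam k j l = 1 := by
    intro j
    rw [Finset.sum_comm]
    simp only [← Finset.mul_sum, (hlam _).2 j, mul_one, hg]
  refine ⟨hg, ?_, ?_⟩
  · intro j l
    simp only [Finset.sum_apply, Pi.smul_apply, smul_eq_mul]
    refine ⟨hnn j l, ?_⟩
    rw [← hone j]
    exact Finset.single_le_sum (f := fun l => ∑ k, g k * lam k j l) (fun l _ => hnn j l)
      (Finset.mem_univ l)
  · intro j
    simpa only [Finset.sum_apply, Pi.smul_apply, smul_eq_mul] using hone j

/-- The sum `∑ₖ λᵏ`, a multiple of the barycentre, which dominates all the `β(g)`. -/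
def total {L : ℕ → ℕ} {K : ℕ} (lam : Fin K → Coeff L) : Coeff L := fun j l => ∑ k, lam k j l

theorem total_nonneg {L : ℕ → ℕ} {K : ℕ} {lam : Fin K → Coeff L} (hlam : ∀ k, lam k ∈ body L)
    (j : ℕ) (l : Fin (L j)) : 0 ≤ total lam j l :=
  Finset.sum_nonneg fun k _ => ((hlam k).1 j l).1

theorem abs_sum_mul_le_total {L : ℕ → ℕ} {K : ℕ} {lam : Fin K → Coeff L}
    (hlam : ∀ k, lam k ∈ body L) (v : Fin K → ℝ) (j : ℕ) (l : Fin (L j)) :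
    |∑ k, v k * lam k j l| ≤ (∑ k, |v k|) * total lam j l := by
  rw [total, Finset.mul_sum]
  refine (Finset.abs_sum_le_sum_abs _ _).trans (Finset.sum_le_sum fun k _ => ?_)
  rw [abs_mul, abs_of_nonneg ((hlam k).1 j l).1]
  exact mul_le_mul_of_nonneg_right
    (Finset.single_le_sum (f := fun k => |v k|) (fun k _ => abs_nonneg _) (Finset.mem_univ k))
    ((hlam k).1 j l).1

theorem sum_mul_eq_zero_of_total_eq_zero {L : ℕ → ℕ} {K : ℕ} {lam : Fin K → Coeff L}
    (hlam : ∀ k, lam k ∈ body L) (v : Fin K → ℝ) {j : ℕ} {l : Fin (L j)}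
    (h : total lam j l = 0) : ∑ k, v k * lam k j l = 0 := by
  simpa [h] using abs_sum_mul_le_total hlam v j l

/-- Under pairwise orthogonality the information in every direction of the hyperplane is
infinite. -/
theorem not_summable_of_pairwiseOrthogonal {L : ℕ → ℕ} {K : ℕ} {lam : Fin K → Coeff L}
    (hlam : ∀ k, lam k ∈ body L) (horth : PairwiseOrthogonal lam)
    {v : Fin K → ℝ} (hv : v ≠ 0) (hv0 : ∑ k, v k = 0) :
    ¬ Summable fun j => ∑ l, (∑ k, v k * lam k j l) ^ 2 / total lam j l := by
  intro hsum
  obtain ⟨k₀, hk₀⟩ := Function.ne_iff.1 hv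
  have hK : (0 : ℝ) < K := Nat.cast_pos.2 (Fin.pos k₀)
  have hN : 0 < ∑ k, |v k| :=
    Finset.sum_pos' (fun k _ => abs_nonneg _) ⟨k₀, Finset.mem_univ _, abs_pos.2 hk₀⟩
  set N := ∑ k, |v k|
  -- The shift by `δ v` changes each entry by at most half of its barycentre value `total / K`, so
  -- positivity survives.
  set δ : ℝ := 1 / (2 * K * N)
  have hδ : 0 < δ := by positivity
  have hδN : δ * N = 1 / (2 * K) := by simp only [δ]; field_simp
  have hp : ∀ j l, ∑ k, (K : ℝ)⁻¹ * lam k j l = (K : ℝ)⁻¹ * total lam j l := fun j l => by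
    rw [total, Finset.mul_sum]
  have hq : ∀ j l, ∑ k, ((K : ℝ)⁻¹ + δ * v k) * lam k j l
      = (K : ℝ)⁻¹ * total lam j l + δ * ∑ k, v k * lam k j l := fun j l => by
    simp only [add_mul, Finset.sum_add_distrib, hp, Finset.mul_sum, mul_assoc]
  have hpm : (fun _ => (K : ℝ)⁻¹ : Fin K → ℝ) ∈ paramSet lam := by
    refine mem_paramSet hlam (by simp [hK.ne']) fun j l => ?_
    rw [hp]
    exact mul_nonneg (inv_nonneg.2 hK.le) (total_nonneg hlam j l)
  have hqm : (fun k => (K : ℝ)⁻¹ + δ * v k : Fin K → ℝ) ∈ paramSet lam := by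
    refine mem_paramSet hlam ?_ fun j l => ?_
    · rw [Finset.sum_add_distrib, ← Finset.mul_sum, hv0]
      simp [hK.ne']
    · rw [hq]
      have h1 := (abs_le.1 (abs_sum_mul_le_total hlam v j l)).1
      have h2 := mul_le_mul_of_nonneg_left h1 hδ.le
      have h3 : δ * -(N * total lam j l) = -(1 / (2 * K)) * total lam j l := by
        rw [← hδN]; ring
      have h4 : (0 : ℝ) ≤ 1 / (2 * K) * total lam j l :=
        mul_nonneg (by positivity) (total_nonneg hlam j l)
      have h5 : (K : ℝ)⁻¹ = 1 / (2 * K) + 1 / (2 * K) := by field_simp; norm_num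
      rw [h3] at h2
      rw [h5]
      linarith
  have hne : (⟨_, hqm⟩ : paramSet lam) ≠ ⟨_, hpm⟩ := by
    intro h
    have := congrFun (congrArg Subtype.val h) k₀
    simp only [add_eq_left, mul_eq_zero, hδ.ne', false_or] at this
    exact hk₀ this
  have hac : indepDist (betaMap lam ⟨_, hqm⟩) ≪ indepDist (betaMap lam ⟨_, hpm⟩) := by
    refine indepDist_absolutelyContinuous _ _ ?_ ?_
    · intro j l h
      rw [betaMap_apply, hp, mul_eq_zero] at h
      rw [betaMap_apply]
      exact sum_mul_eq_zero_of_total_eq_zero hlam _ (h.resolve_left (inv_ne_zero hK.ne'))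
    · refine (hsum.mul_left (δ ^ 2 * K)).congr fun j => ?_
      rw [Finset.mul_sum]
      refine Finset.sum_congr rfl fun l _ => ?_
      rw [betaMap_apply, betaMap_apply, hp, hq, add_sub_cancel_left]
      by_cases h : total lam j l = 0
      · simp [h]
      · field_simp
  have hself := (horth _ _ hne).mono_ac Measure.AbsolutelyContinuous.rfl hac
  exact IsProbabilityMeasure.ne_zero _ ((Measure.MutuallySingular.self_iff _).1 hself)

/-! ### Estimable functionals and their density. -/

/-- The linear functionals of the parameter that are estimated without bias, and with variance at
most `ε` up to a constant depending on the parameter, by a function of the coordinates from the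
`m`-th on. -/
def estimable {L : ℕ → ℕ} {K : ℕ} (lam : Fin K → Coeff L) (m : ℕ) (ε : ℝ) : Set (Fin K → ℝ) :=
  {y | ∃ T : Outcome L → ℝ, Measurable[cylinderEvents {j | m ≤ j}] T ∧ ∀ g : paramSet lam,
    ∫⁻ x, ENNReal.ofReal ((T x - ∑ k, y k * g.1 k) ^ 2) ∂(indepDist (betaMap lam g))
      ≤ ENNReal.ofReal (ε * ∑ k, |g.1 k|)}

/-- Squaring is convex, and the error bound does not involve the functional. -/
theorem convex_estimable {L : ℕ → ℕ} {K : ℕ} (lam : Fin K → Coeff L) (m : ℕ) (ε : ℝ) :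
    Convex ℝ (estimable lam m ε) := by
  rintro y ⟨T, hT, hTy⟩ z ⟨U, hU, hUz⟩ a b ha hb hab
  refine ⟨fun x => a * T x + b * U x, (hT.const_mul a).add (hU.const_mul b), fun g => ?_⟩
  have hT' : Measurable T := hT.mono cylinderEvents_le_pi le_rfl
  have hU' : Measurable U := hU.mono cylinderEvents_le_pi le_rfl
  set s := ∑ k, y k * g.1 k
  set t := ∑ k, z k * g.1 k
  have hst : ∑ k, (a • y + b • z) k * g.1 k = a * s + b * t := by
    simp only [s, t, Finset.mul_sum, ← Finset.sum_add_distrib, Pi.add_apply, Pi.smul_apply,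
      smul_eq_mul]
    exact Finset.sum_congr rfl fun k _ => by ring
  rw [hst]
  have hpt : ∀ x, ENNReal.ofReal ((a * T x + b * U x - (a * s + b * t)) ^ 2)
      ≤ ENNReal.ofReal a * ENNReal.ofReal ((T x - s) ^ 2)
        + ENNReal.ofReal b * ENNReal.ofReal ((U x - t) ^ 2) := by
    intro x
    rw [← ENNReal.ofReal_mul ha, ← ENNReal.ofReal_mul hb,
      ← ENNReal.ofReal_add (by positivity) (by positivity)]
    refine ENNReal.ofReal_le_ofReal ?_
    obtain rfl : b = 1 - a := by linarith
    nlinarith [mul_nonneg (mul_nonneg ha hb) (sq_nonneg ((T x - s) - (U x - t)))]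
  refine (lintegral_mono hpt).trans ?_
  rw [lintegral_add_left (by fun_prop), lintegral_const_mul _ (by fun_prop),
    lintegral_const_mul _ (by fun_prop)]
  refine (add_le_add (mul_le_mul_right (hTy g) _) (mul_le_mul_right (hUz g) _)).trans ?_
  rw [← add_mul, ← ENNReal.ofReal_add ha hb, hab, ENNReal.ofReal_one, one_mul]

theorem lintegral_sq_sum_sub_le {L : ℕ → ℕ} (β : body L) (I : Finset ℕ) (c : Coeff L) :
    ∫⁻ x, ENNReal.ofReal ((∑ j ∈ I, c j (x j) - ∑ j ∈ I, ∑ l, c j l * β.1 j l) ^ 2) ∂(indepDist β)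
      ≤ ENNReal.ofReal (∑ j ∈ I, ∑ l, c j l ^ 2 * β.1 j l) := by
  have hmp : ∀ j, MeasurePreserving (fun x : Outcome L => x j) (indepDist β) (coordDist β.1 j) :=
    fun j => measurePreserving_eval_infinitePi _ j
  have hcm : ∀ j, Measurable (c j) := fun j => .of_discrete
  have hint : ∀ j (f : Fin (L j) → ℝ), ∫ x, f (x j) ∂(indepDist β) = ∑ l, f l * β.1 j l := by
    intro j f
    have h1 : Integrable f (coordDist β.1 j) := .of_finite
    rw [← integral_map (φ := fun x : Outcome L => x j) (f := f) (hmp j).measurable.aemeasurable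
      (by rw [(hmp j).map_eq]; exact h1.1), (hmp j).map_eq, integral_fintype h1]
    exact Finset.sum_congr rfl fun l _ => by
      rw [coordDist_real_singleton, smul_eq_mul, mul_comm]
  have hLp : ∀ j, MemLp (fun x : Outcome L => c j (x j)) 2 (indepDist β) := fun j =>
    (MemLp.of_discrete (f := c j) (μ := coordDist β.1 j)).comp_measurePreserving (hmp j)
  have hindep : iIndepFun (fun j (x : Outcome L) => c j (x j)) (indepDist β) :=
    iIndepFun_infinitePi hcm
  have hsum : MemLp (∑ j ∈ I, fun x : Outcome L => c j (x j)) 2 (indepDist β) :=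
    memLp_finsetSum' I fun j _ => hLp j
  have hvar := IndepFun.variance_sum (s := I) (fun j _ => hLp j)
    fun i _ j _ hij => hindep.indepFun hij
  have hmean : ∫ x, (∑ j ∈ I, fun x : Outcome L => c j (x j)) x ∂(indepDist β)
      = ∑ j ∈ I, ∑ l, c j l * β.1 j l := by
    simp only [Finset.sum_apply]
    rw [integral_finsetSum I fun j _ => (hLp j).integrable (by norm_num)]
    exact Finset.sum_congr rfl fun j _ => hint j (c j)
  calc _ = eVar[∑ j ∈ I, fun x : Outcome L => c j (x j); indepDist β] := by
        rw [evariance, hmean]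
        refine lintegral_congr fun x => ?_
        rw [Finset.sum_apply, ← ofReal_norm, ← ENNReal.ofReal_pow (norm_nonneg _),
          Real.norm_eq_abs, sq_abs]
    _ ≤ _ := by
        rw [← ofReal_variance hsum, hvar]
        refine ENNReal.ofReal_le_ofReal (Finset.sum_le_sum fun j _ => ?_)
        refine (variance_le_expectation_sq (hLp j).1).trans_eq ?_
        exact hint j fun l => c j l ^ 2

/-- The estimator is `d + ∑ c j (x j)`. Constants are admissible because `∑ gₖ = 1`; the variance
bound follows from `β(g) ≤ (∑ |gₖ|) * total`. -/
theorem mem_estimable {L : ℕ → ℕ} {K : ℕ} {lam : Fin K → Coeff L} (hlam : ∀ k, lam k ∈ body L)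
    {m n : ℕ} {ε : ℝ} (d : ℝ) (c : Coeff L)
    (hc : ∑ j ∈ Finset.Ico m n, ∑ l, c j l ^ 2 * total lam j l ≤ ε) :
    (fun k => d + ∑ j ∈ Finset.Ico m n, ∑ l, c j l * lam k j l) ∈ estimable lam m ε := by
  refine ⟨fun x => d + ∑ j ∈ Finset.Ico m n, c j (x j), ?_, fun g => ?_⟩
  · refine Measurable.const_add (Finset.measurable_fun_sum _ fun j hj => ?_) d
    exact (Measurable.of_discrete (f := c j)).comp
      (measurable_cylinderEvent_apply (Finset.mem_Ico.1 hj).1)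
  · have hmean : ∑ k, (d + ∑ j ∈ Finset.Ico m n, ∑ l, c j l * lam k j l) * g.1 k
        = d + ∑ j ∈ Finset.Ico m n, ∑ l, c j l * (betaMap lam g).1 j l := by
      simp only [add_mul, Finset.sum_add_distrib, ← Finset.mul_sum, g.2.1, mul_one,
        betaMap_apply, Finset.sum_mul]
      rw [Finset.sum_comm]
      congr 1
      refine Finset.sum_congr rfl fun j _ => ?_
      rw [Finset.sum_comm]
      refine Finset.sum_congr rfl fun l _ => ?_
      rw [Finset.mul_sum]
      exact Finset.sum_congr rfl fun k _ => by ring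
    simp only [hmean, add_sub_add_left_eq_sub]
    refine (lintegral_sq_sum_sub_le (betaMap lam g) _ c).trans (ENNReal.ofReal_le_ofReal ?_)
    refine le_trans ?_ (mul_le_mul_of_nonneg_right hc (Finset.sum_nonneg fun k _ => abs_nonneg _))
    rw [Finset.sum_mul]
    refine Finset.sum_le_sum fun j _ => ?_
    rw [Finset.sum_mul]
    refine Finset.sum_le_sum fun l _ => ?_
    rw [mul_assoc, mul_comm (total lam j l), betaMap_apply]
    exact mul_le_mul_of_nonneg_left
      ((le_abs_self _).trans (abs_sum_mul_le_total hlam g.1 j l)) (sq_nonneg _)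

theorem dense_estimable {L : ℕ → ℕ} {K : ℕ} {lam : Fin K → Coeff L} (hlam : ∀ k, lam k ∈ body L)
    (horth : PairwiseOrthogonal lam) (m : ℕ) {ε : ℝ} (hε : 0 < ε) :
    Dense (estimable lam m ε) := by
  intro x
  by_contra hx
  obtain ⟨f, u, hfu, hux⟩ :=
    geometric_hahn_banach_closed_point (convex_estimable lam m ε).closure isClosed_closure hx
  set v : Fin K → ℝ := fun k => f (Pi.single k 1)
  have hf : ∀ y, f y = ∑ k, y k * v k := fun y => by
    conv_lhs => rw [← Finset.univ_sum_single y]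
    rw [map_sum]
    refine Finset.sum_congr rfl fun k _ => ?_
    rw [← smul_eq_mul, ← map_smul, ← Pi.single_smul', smul_eq_mul, mul_one]
  have hlt : ∀ (n : ℕ) (d : ℝ) (c : Coeff L),
      ∑ j ∈ Finset.Ico m n, ∑ l, c j l ^ 2 * total lam j l ≤ ε →
      ∑ k, (d + ∑ j ∈ Finset.Ico m n, ∑ l, c j l * lam k j l) * v k < u := fun n d c hc => by
    rw [← hf]
    exact hfu _ (subset_closure (mem_estimable hlam d c hc))
  -- Constant estimators cost no variance, so the separating functional is bounded on a line and
  -- must vanish there: `∑ vₖ = 0`.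
  have hconst : ∀ d : ℝ, d * ∑ k, v k < u := fun d => by
    simpa [Finset.mul_sum] using hlt 0 d 0 (by simpa using hε.le)
  have hu : 0 < u := by simpa using hconst 0
  have hv0 : ∑ k, v k = 0 := by
    by_contra h
    have := hconst (u / ∑ k, v k)
    rw [div_mul_cancel₀ _ h] at this
    exact lt_irrefl _ this
  have hv : v ≠ 0 := by
    intro h
    rw [hf, h] at hux
    simp only [Pi.zero_apply, mul_zero, Finset.sum_const_zero] at hux
    exact lt_asymm hu hux
  set w : ℕ → ℝ := fun j => ∑ l, (∑ k, v k * lam k j l) ^ 2 / total lam j l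
  have hw : ∀ j, 0 ≤ w j := fun j =>
    Finset.sum_nonneg fun l _ => div_nonneg (sq_nonneg _) (total_nonneg hlam j l)
  have htend := (not_summable_iff_tendsto_nat_atTop_of_nonneg hw).1
    (not_summable_of_pairwiseOrthogonal hlam horth hv hv0)
  obtain ⟨n, hmn, hn⟩ := ((Filter.eventually_ge_atTop m).and
    (htend.eventually_ge_atTop (∑ j ∈ Finset.range m, w j + u ^ 2 / ε))).exists
  have hI : u ^ 2 / ε ≤ ∑ j ∈ Finset.Ico m n, w j := by
    rw [Finset.sum_Ico_eq_sub _ hmn]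
    linarith
  set I := ∑ j ∈ Finset.Ico m n, w j
  have hI0 : 0 < I := lt_of_lt_of_le (by positivity) hI
  -- The least-variance weights giving the separating functional the value `u`: their cost is `u ^ 2
  -- / I`, which is at most `ε` once the information `I` is large.
  have := hlt n 0 (fun j l => u / I * ((∑ k, v k * lam k j l) / total lam j l)) ?_
  · refine absurd this (not_lt.2 (le_of_eq ?_))
    calc u = ∑ j ∈ Finset.Ico m n, u / I * w j := by
          rw [← Finset.mul_sum, div_mul_cancel₀ _ hI0.ne']
      _ = _ := by
          simp only [zero_add, Finset.sum_mul]
          rw [Finset.sum_comm]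
          refine Finset.sum_congr rfl fun j _ => ?_
          rw [Finset.sum_comm, Finset.mul_sum]
          refine Finset.sum_congr rfl fun l _ => ?_
          simp only [mul_assoc, ← Finset.mul_sum]
          simp only [mul_comm (lam _ j l)]
          ring
  · calc _ = ∑ j ∈ Finset.Ico m n, (u / I) ^ 2 * w j := by
          refine Finset.sum_congr rfl fun j _ => ?_
          rw [Finset.mul_sum]
          refine Finset.sum_congr rfl fun l _ => ?_
          by_cases h : total lam j l = 0
          · simp [h]
          · field_simp
      _ = u ^ 2 / I := by
          rw [← Finset.mul_sum]
          change (u / I) ^ 2 * I = _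
          field_simp
      _ ≤ ε := by
          rw [div_le_iff₀ hε] at hI
          rw [div_le_iff₀ hI0]
          linarith

/-! ### Recovering the parameter from the tail. -/

/-- Under pairwise orthogonality every coordinate of the parameter is almost surely a function of
the tail of the observations. -/
theorem exists_tail_measurable_estimator_coord {L : ℕ → ℕ} {K : ℕ} {lam : Fin K → Coeff L}
    (hlam : ∀ k, lam k ∈ body L) (horth : PairwiseOrthogonal lam) (k : Fin K) :
    ∃ f : Outcome L → ℝ, Measurable[tail L] f ∧
      ∀ g : paramSet lam, ∀ᵐ x ∂(indepDist (betaMap lam g)), f x = g.1 k := by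
  have hε : ∀ n : ℕ, (0 : ℝ) < (1 / 2) ^ n := fun n => by positivity
  have hex : ∀ n : ℕ, ∃ y ∈ estimable lam n ((1 / 2) ^ n), dist (Pi.single k 1) y < (1 / 2) ^ n :=
    fun n => Metric.mem_closure_iff.1 (dense_estimable hlam horth n (hε n) _) _ (hε n)
  choose y hy hdist using hex
  choose T hT hTy using hy
  have hpow : Filter.Tendsto (fun n : ℕ => ((1 : ℝ) / 2) ^ n) Filter.atTop (nhds 0) :=
    tendsto_pow_atTop_nhds_zero_of_lt_one (by norm_num) (by norm_num)
  have hylim : Filter.Tendsto y Filter.atTop (nhds (Pi.single k 1)) := by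
    rw [tendsto_iff_dist_tendsto_zero]
    refine squeeze_zero (fun _ => dist_nonneg) (fun n => ?_) hpow
    rw [dist_comm]
    exact (hdist n).le
  -- A limsup ignores the first `m` terms, and `T (n + m)` only uses coordinates from `m` on.
  refine ⟨fun x => Filter.limsup (fun n => T n x) Filter.atTop, ?_, fun g => ?_⟩
  · rw [measurable_iff_comap_le]
    refine le_iInf fun m => ?_
    rw [← measurable_iff_comap_le]
    simp only [← fun x => Filter.limsup_nat_add (fun n => T n x) m]
    refine Measurable.limsup fun n => (hT (n + m)).mono ?_ le_rfl
    exact cylinderEvents_mono fun j hj => (Nat.le_add_left m n).trans hj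
  · have hTm : ∀ n, Measurable (T n) := fun n => (hT n).mono cylinderEvents_le_pi le_rfl
    set s : ℕ → ℝ := fun n => ∑ i, y n i * g.1 i
    have hs : Filter.Tendsto s Filter.atTop (nhds (g.1 k)) := by
      have h : Filter.Tendsto s Filter.atTop
          (nhds (∑ i, (Pi.single k 1 : Fin K → ℝ) i * g.1 i)) :=
        tendsto_finsetSum _ fun i _ => ((tendsto_pi_nhds.1 hylim) i).mul_const _
      simpa [Pi.single_apply] using h
    -- Summable mean squared errors make the series of squared errors finite almost surely, so the
    -- errors tend to zero.
    have hfin : ∫⁻ x, ∑' n, ENNReal.ofReal ((T n x - s n) ^ 2) ∂(indepDist (betaMap lam g))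
        ≠ ⊤ := by
      rw [lintegral_tsum fun n => by fun_prop]
      refine ne_top_of_le_ne_top ?_ (ENNReal.tsum_le_tsum fun n => hTy n g)
      exact ((summable_geometric_two).mul_right _).tsum_ofReal_ne_top
    filter_upwards [ae_lt_top (by fun_prop) hfin] with x hx
    have h0 := ENNReal.tendsto_atTop_zero_of_tsum_ne_top hx.ne
    have h1 : Filter.Tendsto (fun n => (T n x - s n) ^ 2) Filter.atTop (nhds 0) := by
      have := (ENNReal.tendsto_toReal ENNReal.zero_ne_top).comp h0
      simpa [Function.comp_def, ENNReal.toReal_ofReal, sq_nonneg] using this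
    have h2 : Filter.Tendsto (fun n => T n x - s n) Filter.atTop (nhds 0) := by
      refine squeeze_zero_norm (fun n => ?_) (by simpa using h1.sqrt)
      rw [Real.norm_eq_abs, Real.sqrt_sq_eq_abs]
    have h3 := h2.add hs
    simp only [sub_add_cancel, zero_add] at h3
    exact h3.limsup_eq

theorem exists_tail_measurable_estimator {L : ℕ → ℕ} {K : ℕ} {lam : Fin K → Coeff L}
    (hlam : ∀ k, lam k ∈ body L) (horth : PairwiseOrthogonal lam) :
    ∃ f : Outcome L → Fin K → ℝ, Measurable[tail L] f ∧
      ∀ g : paramSet lam, ∀ᵐ x ∂(indepDist (betaMap lam g)), f x = g.1 := by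
  choose f hf hfg using exists_tail_measurable_estimator_coord hlam horth
  refine ⟨fun x k => f k x, @measurable_pi_lambda _ _ _ (tail L) _ _ hf, fun g => ?_⟩
  filter_upwards [ae_all_iff.2 fun k => hfg k g] with x hx
  exact funext hx

/-- Under pairwise orthogonality every Borel set of parameters is decided by a tail event. -/
theorem exists_tail_event {L : ℕ → ℕ} {K : ℕ} {lam : Fin K → Coeff L}
    (hlam : ∀ k, lam k ∈ body L) (horth : PairwiseOrthogonal lam)
    {B : Set (paramSet lam)} (hB : MeasurableSet B) :
    ∃ A : Set (Outcome L), MeasurableSet[tail L] A ∧ ∀ g : paramSet lam,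
      (g ∈ B → indepDist (betaMap lam g) Aᶜ = 0) ∧ (g ∉ B → indepDist (betaMap lam g) A = 0) := by
  obtain ⟨f, hf, hfg⟩ := exists_tail_measurable_estimator hlam horth
  obtain ⟨t, ht, rfl⟩ := hB
  refine ⟨f ⁻¹' t, hf ht, fun g => ⟨fun hg => ?_, fun hg => ?_⟩⟩
  · refine mem_ae_iff.1 ?_
    filter_upwards [hfg g] with x hx
    rw [Set.mem_preimage, hx]
    exact hg
  · refine measure_eq_zero_iff_ae_notMem.2 ?_
    filter_upwards [hfg g] with x hx
    rw [Set.mem_preimage, hx]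
    exact hg

/-! ### Zero–one law, mixtures, and the converse implications. -/

theorem indepDist_eq_zero_or_one {L : ℕ → ℕ} (β : body L) {A : Set (Outcome L)}
    (hA : MeasurableSet[tail L] A) : indepDist β A = 0 ∨ indepDist β A = 1 := by
  have hindep : iIndepFun (fun j (x : Outcome L) => x j) (indepDist β) :=
    iIndepFun_infinitePi (X := fun j (l : Fin (L j)) => l) fun _ => measurable_id
  refine measure_zero_or_one_of_measurableSet_limsup_atTop
    (fun j => (measurable_pi_apply j).comap_le) hindep ?_
  rw [Filter.limsup_eq_iInf_iSup_of_nat]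
  exact hA

theorem tailOrthogonal_of_event {L : ℕ → ℕ} {P P' : Measure (Outcome L)} {A : Set (Outcome L)}
    (hA : MeasurableSet[tail L] A) (h : P A = 0) (h' : P' Aᶜ = 0) : TailOrthogonal P P' := by
  refine ⟨A, hA, ?_, ?_⟩
  · rw [trim_measurableSet_eq _ hA, h]
  · rw [trim_measurableSet_eq _ hA.compl, h']

theorem TailOrthogonal.mutuallySingular {L : ℕ → ℕ} {P P' : Measure (Outcome L)}
    (h : TailOrthogonal P P') : P.MutuallySingular P' := by
  obtain ⟨A, hA, h1, h2⟩ := h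
  rw [trim_measurableSet_eq _ hA] at h1
  rw [trim_measurableSet_eq _ hA.compl] at h2
  exact ⟨A, tail_le L _ hA, h1, h2⟩

theorem tailOrthogonal_mix {L : ℕ → ℕ} {K : ℕ} {lam : Fin K → Coeff L}
    (hlam : ∀ k, lam k ∈ body L) (horth : PairwiseOrthogonal lam)
    {μ₁ μ₂ : Measure (paramSet lam)} (hμ : μ₁.MutuallySingular μ₂) :
    TailOrthogonal (mix lam μ₁) (mix lam μ₂) := by
  obtain ⟨B, hB, h1, h2⟩ := hμ
  obtain ⟨A, hA, hAB⟩ := exists_tail_event hlam horth hB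
  refine tailOrthogonal_of_event hA ?_ ?_
  · rw [mix_apply lam _ (tail_le L _ hA)]
    refine lintegral_eq_zero_of_ae_eq_zero ?_
    filter_upwards [measure_eq_zero_iff_ae_notMem.1 h1] with g hg
    exact (hAB g).2 hg
  · rw [mix_apply lam _ (tail_le L _ hA).compl]
    refine lintegral_eq_zero_of_ae_eq_zero ?_
    filter_upwards [measure_eq_zero_iff_ae_notMem.1 h2] with g hg
    exact (hAB g).1 (not_not.1 hg)

theorem pairwiseOrthogonal_of_mix {L : ℕ → ℕ} {K : ℕ} {lam : Fin K → Coeff L}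
    (h : ∀ μ₁ μ₂ : Measure (paramSet lam), IsProbabilityMeasure μ₁ → IsProbabilityMeasure μ₂ →
      μ₁.MutuallySingular μ₂ → (mix lam μ₁).MutuallySingular (mix lam μ₂)) :
    PairwiseOrthogonal lam := by
  intro g g' hne
  have hdirac : ∀ a, mix lam (Measure.dirac a) = indepDist (betaMap lam a) := fun a =>
    Measure.dirac_bind (indepKernel lam).measurable a
  rw [← hdirac, ← hdirac]
  refine h _ _ inferInstance inferInstance ⟨{g'}, measurableSet_singleton _, ?_, ?_⟩
  · simp [hne]
  · simp

theorem pairwiseOrthogonal_of_tail_events {L : ℕ → ℕ} {K : ℕ} {lam : Fin K → Coeff L}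
    (h : ∀ μ : Measure (paramSet lam), IsProbabilityMeasure μ → ∀ B : Set (paramSet lam),
      MeasurableSet B → ∃ A : Set (Outcome L), MeasurableSet[tail L] A ∧
        μ (symmDiff B (hMap lam A)) = 0) :
    PairwiseOrthogonal lam := by
  intro g g' hne
  -- A null set of this mixture contains neither `g` nor `g'`, so (c) with `B = {g}` gives a tail
  -- event of probability one under `P_g` but not under `P_g'`; the zero–one law then makes the
  -- latter probability zero.
  have hprob : IsProbabilityMeasure
      ((2⁻¹ : ENNReal) • Measure.dirac g + (2⁻¹ : ENNReal) • Measure.dirac g') :=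
    ⟨by simp [ENNReal.inv_two_add_inv_two]⟩
  obtain ⟨A, hA, hAB⟩ := h _ hprob {g} (measurableSet_singleton g)
  simp only [Measure.coe_add, Measure.coe_smul, Pi.add_apply, Pi.smul_apply, smul_eq_mul,
    add_eq_zero, mul_eq_zero, ENNReal.inv_eq_zero, ENNReal.ofNat_ne_top, false_or] at hAB
  have hnot : ∀ a, Measure.dirac a (symmDiff {g} (hMap lam A)) = 0 →
      a ∉ symmDiff {g} (hMap lam A) := fun a ha hmem => by
    simp [Measure.dirac_apply_of_mem hmem] at ha
  have h1 : indepDist (betaMap lam g) A = 1 := by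
    by_contra hcon
    exact hnot g hAB.1 (Or.inl ⟨rfl, hcon⟩)
  have h2 : indepDist (betaMap lam g') A ≠ 1 := fun hcon =>
    hnot g' hAB.2 (Or.inr ⟨hcon, hne.symm⟩)
  refine ⟨Aᶜ, (tail_le L _ hA).compl, ?_, ?_⟩
  · rw [prob_compl_eq_zero_iff (tail_le L _ hA), h1]
  · rw [compl_compl]
    exact (indepDist_eq_zero_or_one _ hA).resolve_right h2

theorem exists_hMap_eq {L : ℕ → ℕ} {K : ℕ} {lam : Fin K → Coeff L}
    (hlam : ∀ k, lam k ∈ body L) (horth : PairwiseOrthogonal lam)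
    {B : Set (paramSet lam)} (hB : MeasurableSet B) :
    ∃ A : Set (Outcome L), MeasurableSet[tail L] A ∧ hMap lam A = B := by
  obtain ⟨A, hA, hAB⟩ := exists_tail_event hlam horth hB
  refine ⟨A, hA, Set.ext fun g => ⟨fun hg => ?_, fun hg => ?_⟩⟩
  · by_contra hgB
    rw [hMap, Set.mem_ofPred_eq, (hAB g).2 hgB] at hg
    exact zero_ne_one hg
  · exact (prob_compl_eq_zero_iff (tail_le L _ hA)).1 ((hAB g).1 hg)

end IndepMix

theorem mainTheorem4 (L : ℕ → ℕ) (K : ℕ) (lam : Fin K → IndepMix.Coeff L)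
    (hlam_mem : ∀ k, lam k ∈ IndepMix.body L) (hlam_indep : LinearIndependent ℝ lam) :
    (IndepMix.PairwiseOrthogonal lam →
      ∀ μ₁ μ₂ : Measure (IndepMix.paramSet lam),
        IsProbabilityMeasure μ₁ → IsProbabilityMeasure μ₂ → μ₁.MutuallySingular μ₂ →
          (IndepMix.mix lam μ₁).MutuallySingular (IndepMix.mix lam μ₂) ∧
          IndepMix.TailOrthogonal (IndepMix.mix lam μ₁) (IndepMix.mix lam μ₂)) ∧
    List.TFAE [
      ∀ μ₁ μ₂ : Measure (IndepMix.paramSet lam),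
        IsProbabilityMeasure μ₁ → IsProbabilityMeasure μ₂ → μ₁.MutuallySingular μ₂ →
          (IndepMix.mix lam μ₁).MutuallySingular (IndepMix.mix lam μ₂),
      ∀ μ₁ μ₂ : Measure (IndepMix.paramSet lam),
        IsProbabilityMeasure μ₁ → IsProbabilityMeasure μ₂ → μ₁.MutuallySingular μ₂ →
          IndepMix.TailOrthogonal (IndepMix.mix lam μ₁) (IndepMix.mix lam μ₂),
      ∀ μ : Measure (IndepMix.paramSet lam), IsProbabilityMeasure μ →
        ∀ B : Set (IndepMix.paramSet lam), MeasurableSet B →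
          ∃ A : Set (IndepMix.Outcome L), MeasurableSet[IndepMix.tail L] A ∧
            μ (symmDiff B (IndepMix.hMap lam A)) = 0] := by
  have hpair := @IndepMix.tailOrthogonal_mix L K lam hlam_mem
  refine ⟨fun horth μ₁ μ₂ _ _ hμ => ⟨(hpair horth hμ).mutuallySingular, hpair horth hμ⟩, ?_⟩
  tfae_have 1 → 3 := fun h μ _ B hB => by
    obtain ⟨A, hA, hAB⟩ :=
      IndepMix.exists_hMap_eq hlam_mem (IndepMix.pairwiseOrthogonal_of_mix h) hB
    exact ⟨A, hA, by simp [hAB]⟩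
  tfae_have 3 → 2 := fun h μ₁ μ₂ _ _ hμ =>
    hpair (IndepMix.pairwiseOrthogonal_of_tail_events h) hμ
  tfae_have 2 → 1 := fun h μ₁ μ₂ h₁ h₂ hμ => (h μ₁ μ₂ h₁ h₂ hμ).mutuallySingular
  tfae_finish
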